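/- Let $\kappa$ be a field and $G$ a group. A function $\sigma:G\times G\to\kappa$ is a \emph{factor set} if there are a unital associative $\kappa$-algebra $R$ and a map $\Gamma:G\to R$ with $\Gamma(1)=1$ such that, for all $g,h\in G$: if $\sigma(g,h)=0$ then $\Gamma(g^{-1})\Gamma(gh)=0=\Gamma(gh)\Gamma(h^{-1})$; if $\Gamma(g)\Gamma(h)=0$ then $\sigma(g,h)=0$; and $\Gamma(g^{-1})\Gamma(g)\Gamma(h)=\sigma(g,h)\Gamma(g^{-1})\Gamma(gh)$, $\Gamma(g)\Gamma(h)\Gamma(h^{-1})=\sigma(g,h)\Gamma(gh)\Gamma(h^{-1})$. The twisted partial group algebra $\kappa_{par}^\sigma G$ is the universal unital $\kappa$-algebra generated by symbols $[g]^\sigma$ $(g\in G)$ subject to $[1]^\sigma=1$, to $[g^{-1}]^\sigma[gh]^\sigma=[gh]^\sigma[h^{-1}]^\sigma=0$ whenever $\sigma(g,h)=0$, and to $[g^{-1}]^\sigma[g]^\sigma[h]^\sigma=\sigma(g,h)[g^{-1}]^\sigma[gh]^\sigma$ and $[g]^\sigma[h]^\sigma[h^{-1}]^\sigma=\sigma(g,h)[gh]^\sigma[h^{-1}]^\sigma$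 for all $g,h\in G$. Put $e_g^\sigma=\sigma(g,g^{-1})^{-1}[g]^\sigma[g^{-1}]^\sigma$ if $\sigma(g,g^{-1})\ne0$ and $e_g^\sigma=0$ otherwise, and let $B^\sigma$ be the (commutative) subalgebra of $\kappa_{par}^\sigma G$ generated by all $e_g^\sigma$. For the constant function $\sigma=1$ write $B$ and $e_g=[g][g^{-1}]$ for $B^\sigma$ and $e_g^\sigma$. \textbf{Proposition.} Let $\sigma$ be a factor set of $G$ over $\kappa$. (0) $B$ is the free commutative unital $\kappa$-algebra on idempotents $e_g$ $(g\in G)$ with $e_1=1$: the $e_g$ are idempotents with $e_1=1$, and for every commutative unital $\kappa$-algebra $A$ and every family of idempotents $(a_g)_{g\in G}$ of $A$ with $a_1=1$ there is a unique unital $\kappa$-algebra homomorphism $B\to A$ with $e_g\mapsto a_g$ for all $g$. (1) Let $\mathcal I_\sigma$ be the ideal of $B$ generated by the elements $e_se_{sg}e_{sgh}$ with $s,g,h\in G$, $\sigma(g,h)=0$, and $e_se_{sg}e_{sgh}e_{sght}$ with $s,g,h,t\in G$, $\sigma(g,h)\sigma(gh,t)\neq\sigma(g,ht)\sigma(h,t)$.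 Then there is an isomorphism of $\kappa$-algebras $B/\mathcal I_\sigma\cong B^\sigma$ that maps the class of $e_g$ to $e_g^\sigma$ for every $g\in G$. (2) The $\sigma$-prohibitions are the sets $\{h,hg,hgs\}$ with $\sigma(g,s)=0$ and the sets $\{h,hg,hgs,hgst\}$ with $\sigma(g,st)\sigma(s,t)\ne\sigma(g,s)\sigma(gs,t)$. Let $\Omega_\sigma$ be the set of all $\xi\subseteq G$ with $1\in\xi$ that contain no $\sigma$-prohibition, with the topology induced by the product topology of $\{0,1\}^G$ ($\{0,1\}$ discrete). For every $\xi\subseteq G$ with $1\in\xi$ there is a unique homomorphism of $\kappa$-algebras $f_\xi:B\to\kappa$ with $f_\xi(e_g)=1$ for $g\in\xi$ and $f_\xi(e_g)=0$ for $g\notin\xi$, and $\xi\in\Omega_\sigma$ if and only if $\mathcal I_\sigma\subseteq\ker f_\xi$. (3) The prime spectrum $\operatorname{Spec}B^\sigma$ with the Zariski topology is homeomorphic to $\Omega_\sigma$ via $\mathfrak p\mapsto\{g\in G: e_g^\sigma\notin\mathfrak p\}$. -/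

import Mathlib

universe w w' u v

namespace TwistedPartial

variable {κ : Type u} {G : Type v} [Field κ] [Group G]

/-- `Γ : G → R` is a partial projective representation of `G` with factor set `σ`. -/
structure IsPartialProjectiveRep {R : Type w} [Ring R] [Algebra κ R]
    (σ : G → G → κ) (Γ : G → R) : Prop where
  eq_zero_of_factor_eq_zero : ∀ g h : G, σ g h = 0 →
    Γ g⁻¹ * Γ (g * h) = 0 ∧ Γ (g * h) * Γ h⁻¹ = 0
  factor_eq_zero : ∀ g h : G, Γ g * Γ h = 0 → σ g h = 0
  map_one : Γ 1 = 1
  left_mul : ∀ g h : G, Γ g⁻¹ * Γ g * Γ h = σ g h • (Γ g⁻¹ * Γ (g * h))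
  right_mul : ∀ g h : G, Γ g * Γ h * Γ h⁻¹ = σ g h • (Γ (g * h) * Γ h⁻¹)

/-- `σ` is a factor set: it is the factor set of some partial projective representation of `G`
in some unital `κ`-algebra. -/
def IsFactorSet (σ : G → G → κ) : Prop :=
  ∃ (R : Type w) (_ : Ring R) (_ : Algebra κ R) (Γ : G → R), IsPartialProjectiveRep σ Γ

open FreeAlgebra in
/-- The defining relations of the twisted partial group algebra. The symbol of `1` is the identity
of the algebra, which is what the relations `[g][1] = [1][g] = [g]` say in the algebra
generated by the symbols. -/
inductive Rel (σ : G → G → κ) : FreeAlgebra κ G → FreeAlgebra κ G → Prop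
  | zero_left (g h : G) : σ g h = 0 → Rel σ (ι κ g⁻¹ * ι κ (g * h)) 0
  | zero_right (g h : G) : σ g h = 0 → Rel σ (ι κ (g * h) * ι κ h⁻¹) 0
  | left_mul (g h : G) :
      Rel σ (ι κ g⁻¹ * ι κ g * ι κ h) (σ g h • (ι κ g⁻¹ * ι κ (g * h)))
  | right_mul (g h : G) :
      Rel σ (ι κ g * ι κ h * ι κ h⁻¹) (σ g h • (ι κ (g * h) * ι κ h⁻¹))
  | one : Rel σ (ι κ 1) 1

/-- The twisted partial group algebra: the universal unital `κ`-algebra on symbols `[g]`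
subject to the above relations. -/
def KPar (σ : G → G → κ) : Type (max u v) := RingQuot (Rel σ)

noncomputable instance (σ : G → G → κ) : Ring (KPar σ) :=
  inferInstanceAs (Ring (RingQuot (Rel σ)))

noncomputable instance (σ : G → G → κ) : Algebra κ (KPar σ) :=
  inferInstanceAs (Algebra κ (RingQuot (Rel σ)))

/-- The canonical projection from the free algebra. -/
noncomputable def mkHom (σ : G → G → κ) : FreeAlgebra κ G →ₐ[κ] KPar σ :=
  RingQuot.mkAlgHom κ (Rel σ)

/-- The generator `[g]`. -/
noncomputable def gen (σ : G → G → κ) (g : G) : KPar σ :=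
  mkHom σ (FreeAlgebra.ι κ g)

/-- `σ(g,g⁻¹)⁻¹ [g][g⁻¹]` if `σ(g,g⁻¹) ≠ 0`, and `0` otherwise (as `0⁻¹ = 0` in `κ`). -/
noncomputable def idem (σ : G → G → κ) (g : G) : KPar σ :=
  (σ g g⁻¹)⁻¹ • (gen σ g * gen σ g⁻¹)

section Facts

variable (σ : G → G → κ)

theorem mkHom_rel {x y : FreeAlgebra κ G} (h : Rel σ x y) : mkHom σ x = mkHom σ y :=
  RingQuot.mkAlgHom_rel κ h

theorem gen_one : gen σ 1 = 1 := by
  simpa [gen] using mkHom_rel σ (Rel.one (σ := σ))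

theorem gen_left_mul (g h : G) :
    gen σ g⁻¹ * gen σ g * gen σ h = σ g h • (gen σ g⁻¹ * gen σ (g * h)) := by
  simpa [gen] using mkHom_rel σ (Rel.left_mul (σ := σ) g h)

theorem gen_right_mul (g h : G) :
    gen σ g * gen σ h * gen σ h⁻¹ = σ g h • (gen σ (g * h) * gen σ h⁻¹) := by
  simpa [gen] using mkHom_rel σ (Rel.right_mul (σ := σ) g h)

theorem gen_zero_left (g h : G) (H : σ g h = 0) : gen σ g⁻¹ * gen σ (g * h) = 0 := by
  simpa [gen] using mkHom_rel σ (Rel.zero_left (σ := σ) g h H)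

theorem gen_zero_right (g h : G) (H : σ g h = 0) : gen σ (g * h) * gen σ h⁻¹ = 0 := by
  simpa [gen] using mkHom_rel σ (Rel.zero_right (σ := σ) g h H)

theorem gen_eq_zero (g : G) (H : σ g⁻¹ g = 0) : gen σ g = 0 := by
  simpa [gen_one] using gen_zero_left σ g⁻¹ g H

theorem gen_mul_inv_mul (g : G) :
    gen σ g * gen σ g⁻¹ * gen σ g = σ g g⁻¹ • gen σ g := by
  simpa [gen_one] using gen_right_mul σ g g⁻¹

theorem isIdempotentElem_idem (g : G) : IsIdempotentElem (idem σ g) := by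
  unfold IsIdempotentElem idem
  by_cases H : σ g g⁻¹ = 0
  · simp [H]
  · rw [smul_mul_smul_comm, ← mul_assoc, gen_mul_inv_mul, smul_mul_assoc, smul_smul,
      mul_assoc, inv_mul_cancel₀ H, mul_one]

theorem exists_smul_eq (g h : G) : ∃ c : κ, idem σ g * idem σ h = c • (idem σ h * idem σ g) := by
  by_cases Hg : σ g g⁻¹ = 0
  · exact ⟨0, by simp [idem, Hg]⟩
  by_cases Hh : σ h h⁻¹ = 0
  · exact ⟨0, by simp [idem, Hh]⟩
  obtain ⟨x, rfl⟩ : ∃ x, g = h * x := ⟨h⁻¹ * g, by group⟩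
  have P1 : gen σ (h * x)⁻¹ * gen σ h * gen σ h⁻¹
      = σ (h * x)⁻¹ h • (gen σ x⁻¹ * gen σ h⁻¹) := by
    simpa using gen_right_mul σ (h * x)⁻¹ h
  have P2 : gen σ (h * x) * gen σ x⁻¹ * gen σ x = σ (h * x) x⁻¹ • (gen σ h * gen σ x) := by
    simpa using gen_right_mul σ (h * x) x⁻¹
  have P3 : gen σ x * gen σ x⁻¹ * gen σ h⁻¹
      = σ x⁻¹ h⁻¹ • (gen σ x * gen σ (h * x)⁻¹) := by
    simpa using gen_left_mul σ x⁻¹ h⁻¹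
  have P4 : gen σ h⁻¹ * gen σ h * gen σ x = σ h x • (gen σ h⁻¹ * gen σ (h * x)) :=
    gen_left_mul σ h x
  by_cases Hx : σ x⁻¹ x = 0
  · have hx' : gen σ x⁻¹ = 0 := by
      simpa [gen_one] using gen_zero_right σ x⁻¹ x Hx
    refine ⟨0, ?_⟩
    have : gen σ (h * x) * gen σ (h * x)⁻¹ * (gen σ h * gen σ h⁻¹) = 0 := by
      have : gen σ (h * x) * gen σ (h * x)⁻¹ * (gen σ h * gen σ h⁻¹)
        = gen σ (h * x) * (gen σ (h * x)⁻¹ * gen σ h * gen σ h⁻¹) := by noncomm_ring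
      rw [this, P1, hx']; simp
    rw [idem, idem, smul_mul_smul_comm, this, smul_zero, zero_smul]
  have Q1 : gen σ x⁻¹ = (σ x⁻¹ x)⁻¹ • (gen σ x⁻¹ * gen σ x * gen σ x⁻¹) := by
    have := gen_mul_inv_mul σ x⁻¹
    rw [inv_inv] at this
    rw [this, smul_smul, inv_mul_cancel₀ Hx, one_smul]
  have Q2 : gen σ h = (σ h h⁻¹)⁻¹ • (gen σ h * gen σ h⁻¹ * gen σ h) := by
    rw [gen_mul_inv_mul, smul_smul, inv_mul_cancel₀ Hh, one_smul]
  have key : ∃ c : κ, gen σ (h * x) * gen σ (h * x)⁻¹ * (gen σ h * gen σ h⁻¹)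
      = c • (gen σ h * gen σ h⁻¹ * (gen σ (h * x) * gen σ (h * x)⁻¹)) := by
    have E1 : gen σ (h * x) * gen σ (h * x)⁻¹ * (gen σ h * gen σ h⁻¹)
        = σ (h * x)⁻¹ h • (gen σ (h * x) * gen σ x⁻¹ * gen σ h⁻¹) := by
      have : gen σ (h * x) * gen σ (h * x)⁻¹ * (gen σ h * gen σ h⁻¹)
        = gen σ (h * x) * (gen σ (h * x)⁻¹ * gen σ h * gen σ h⁻¹) := by noncomm_ring
      rw [this, P1, mul_smul_comm, ← mul_assoc]
    have E2 : gen σ (h * x) * gen σ x⁻¹ * gen σ h⁻¹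
        = ((σ x⁻¹ x)⁻¹ * σ (h * x) x⁻¹) • (gen σ h * gen σ x * gen σ x⁻¹ * gen σ h⁻¹) := by
      rw [Q1]
      have : gen σ (h * x) * (gen σ x⁻¹ * gen σ x * gen σ x⁻¹) * gen σ h⁻¹
        = (gen σ (h * x) * gen σ x⁻¹ * gen σ x) * gen σ x⁻¹ * gen σ h⁻¹ := by noncomm_ring
      rw [mul_smul_comm, smul_mul_assoc, this, P2, smul_mul_assoc, smul_mul_assoc, smul_smul, ← Q1]
    have E3 : gen σ h * gen σ x * gen σ x⁻¹ * gen σ h⁻¹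
        = σ x⁻¹ h⁻¹ • (gen σ h * gen σ x * gen σ (h * x)⁻¹) := by
      have : gen σ h * gen σ x * gen σ x⁻¹ * gen σ h⁻¹
        = gen σ h * (gen σ x * gen σ x⁻¹ * gen σ h⁻¹) := by noncomm_ring
      rw [this, P3, mul_smul_comm, ← mul_assoc]
    have E4 : gen σ h * gen σ x * gen σ (h * x)⁻¹
        = ((σ h h⁻¹)⁻¹ * σ h x) •
          (gen σ h * gen σ h⁻¹ * (gen σ (h * x) * gen σ (h * x)⁻¹)) := by
      have F : gen σ h * gen σ x = (σ h h⁻¹)⁻¹ • (gen σ h * (gen σ h⁻¹ * gen σ h * gen σ x)) := by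
        conv_lhs => rw [Q2]
        rw [smul_mul_assoc]
        congr 1
        noncomm_ring
      rw [F, P4, mul_smul_comm, smul_smul, smul_mul_assoc]
      congr 1
      noncomm_ring
    exact ⟨_, by rw [E1, E2, E3, E4, smul_smul, smul_smul, smul_smul]⟩
  obtain ⟨c, hc⟩ := key
  refine ⟨c, ?_⟩
  simp only [idem, smul_mul_smul_comm, hc, smul_smul]
  congr 1
  ring

theorem idem_mul_comm (g h : G) : idem σ g * idem σ h = idem σ h * idem σ g := by
  obtain ⟨c, hc⟩ := exists_smul_eq σ g h
  obtain ⟨d, hd⟩ := exists_smul_eq σ h g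
  have ha := isIdempotentElem_idem σ g
  have hb := isIdempotentElem_idem σ h
  generalize idem σ g = a at *
  generalize idem σ h = b at *
  have h1 : b * a * b = c • (b * a) := by
    rw [mul_assoc, hc, mul_smul_comm, ← mul_assoc, hb.eq]
  have h2 : a * b = c • (a * b) := by
    calc a * b = a * b * b := by rw [mul_assoc, hb.eq]
      _ = c • (a * b) := by rw [hc, smul_mul_assoc, h1]
  by_cases H : c = 1
  · rw [hc, H, one_smul]
  · have h3 : (1 - c) • (a * b) = 0 := by rw [sub_smul, one_smul, ← h2, sub_self]
    have h4 : a * b = 0 := (smul_eq_zero.mp h3).resolve_left (sub_ne_zero.mpr (Ne.symm H))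
    rw [hd, h4, smul_zero]

end Facts

/-- `B^σ`: the subalgebra of the twisted partial group algebra generated by the elements
`e_g^σ`. -/
noncomputable def Bsigma (σ : G → G → κ) : Subalgebra κ (KPar σ) :=
  Algebra.adjoin κ (Set.range (idem σ))

noncomputable instance (σ : G → G → κ) : CommRing (Bsigma σ) :=
  { (Bsigma σ).toRing with
    mul_comm :=
      (Algebra.isMulCommutative_adjoin κ (s := Set.range (idem σ)) (by
        rintro _ ⟨g, rfl⟩ _ ⟨h, rfl⟩
        exact idem_mul_comm σ g h)).is_comm.comm }

/-- `e_g^σ` as an element of `B^σ`. -/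
noncomputable def eSigma (σ : G → G → κ) (g : G) : Bsigma σ :=
  ⟨idem σ g, Algebra.subset_adjoin ⟨g, rfl⟩⟩

variable (κ G) in
/-- `B`: the algebra `B^σ` for the trivial factor set `σ = 1`, i.e. the subalgebra of the partial
group algebra generated by the idempotents `[g][g⁻¹]`. -/
noncomputable abbrev B : Subalgebra κ (KPar (fun _ _ : G => (1 : κ))) :=
  Bsigma (fun _ _ : G => (1 : κ))

variable (κ) in
/-- The generator `e_g = [g][g⁻¹]` of `B`. -/
noncomputable abbrev e (g : G) : B κ G := eSigma (fun _ _ : G => (1 : κ)) g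

/-- The ideal `I_σ` of `B`. -/
noncomputable def Isigma (σ : G → G → κ) : Ideal (B κ G) :=
  Ideal.span
    ({x | ∃ s g h : G, σ g h = 0 ∧ x = e κ s * e κ (s * g) * e κ (s * g * h)} ∪
     {x | ∃ s g h t : G, σ g h * σ (g * h) t ≠ σ g (h * t) * σ h t ∧
        x = e κ s * e κ (s * g) * e κ (s * g * h) * e κ (s * g * h * t)})

/-- The `σ`-prohibitions of type I. -/
def prohibitionsI (σ : G → G → κ) : Set (Set G) :=
  {V | ∃ h g s : G, σ g s = 0 ∧ V = {h, h * g, h * g * s}}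

/-- The `σ`-prohibitions of type II. -/
def prohibitionsII (σ : G → G → κ) : Set (Set G) :=
  {V | ∃ h g s t : G, σ g (s * t) * σ s t ≠ σ g s * σ (g * s) t ∧
    V = {h, h * g, h * g * s, h * g * s * t}}

/-- The set of `σ`-prohibitions. -/
def prohibitions (σ : G → G → κ) : Set (Set G) := prohibitionsI σ ∪ prohibitionsII σ

/-- The subset of `G` with indicator function `ξ`. The Bernoulli space `2^G` is `G → Bool` with
the product of the discrete topologies. -/
def toSet (ξ : G → Bool) : Set G := {g | ξ g = true}

/-- `Ω_σ`: the space of the subsets of `G` that contain `1` and contain no `σ`-prohibition, as a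
subspace of the Bernoulli space. -/
def OmegaSigma (σ : G → G → κ) : Set (G → Bool) :=
  {ξ | 1 ∈ toSet ξ ∧ ∀ V ∈ prohibitions σ, ¬ V ⊆ toSet ξ}

end TwistedPartial

/-! Over a field, a commutative algebra generated by idempotents is governed by its rational points:
near any prime each element is a scalar, so primes are kernels of points (`exists_algHom_ker_eq`),
and the points separate elements (`eq_zero_of_forall_algHom`). Hence a surjection between such
algebras is injective as soon as every point of the source factors through the target.

A point of `B^σ` sends each `e_g` to 0 or 1, so it is a subset `ξ` of `G` containing 1. The
covariance `[g] e_h = e_{gh} [g]` (`gen_mul_idem`) and associativity of `[g][h][t]` kill the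
products of `e`'s along prohibitions, so `ξ` lies in `Ω_σ`. Conversely, each `ξ` in `Ω_σ` carries a
truncated twisted regular representation `opGen`; reading the action of `B^σ` at the coordinate 1
gives the required point (`exists_algHom_of_mem_omega`). The case `σ = 1`, where nothing is
prohibited, gives all points of `B`.

The factor set hypothesis enters only through `factor_one_left`, which makes `[1]` act as the
identity. -/

namespace TwistedPartial

/-! ### Algebras generated by idempotents and their rational points. -/

section GeneratedByIdempotents

variable {κ : Type*} {C : Type*} {ι : Type*} [Field κ] [CommRing C] [Algebra κ C] {c : ι → C}

/-- An element of an algebra generated by idempotents agrees with a scalar in a basic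
neighbourhood of a given prime. -/
theorem exists_notMem_mul_eq (hc : ∀ i, IsIdempotentElem (c i))
    (htop : Algebra.adjoin κ (Set.range c) = ⊤) (p : Ideal C) [hp : p.IsPrime] (x : C) :
    ∃ (a : κ) (u : C), u ∉ p ∧ u * x = u * algebraMap κ C a := by
  have hx : x ∈ Algebra.adjoin κ (Set.range c) := htop ▸ Algebra.mem_top
  induction hx using Algebra.adjoin_induction with
  | mem x hx =>
    obtain ⟨i, rfl⟩ := hx
    -- An idempotent is 0 where `1 - c i` is invertible and 1 where `c i` is.
    by_cases hi : c i ∈ p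
    · refine ⟨0, 1 - c i, fun h => ?_, ?_⟩
      · exact hp.ne_top ((Ideal.eq_top_iff_one _).2 (by simpa using add_mem h hi))
      · rw [sub_mul, (hc i).eq]
        simp
    · exact ⟨1, c i, hi, by rw [(hc i).eq]; simp⟩
  | algebraMap r => exact ⟨r, 1, fun h => hp.ne_top ((Ideal.eq_top_iff_one _).2 h), rfl⟩
  | add x y _ _ hx hy =>
    obtain ⟨a, u, hu, hx⟩ := hx
    obtain ⟨b, v, hv, hy⟩ := hy
    refine ⟨a + b, u * v, fun h => (hp.mem_or_mem h).elim hu hv, ?_⟩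
    rw [map_add]
    linear_combination v * hx + u * hy
  | mul x y _ _ hx hy =>
    obtain ⟨a, u, hu, hx⟩ := hx
    obtain ⟨b, v, hv, hy⟩ := hy
    refine ⟨a * b, u * v, fun h => (hp.mem_or_mem h).elim hu hv, ?_⟩
    rw [map_mul]
    linear_combination v * y * hx + u * algebraMap κ C a * hy

/-- The primes of an algebra generated by idempotents are the kernels of its rational points. -/
theorem exists_algHom_ker_eq (hc : ∀ i, IsIdempotentElem (c i))
    (htop : Algebra.adjoin κ (Set.range c) = ⊤) (p : Ideal C) [hp : p.IsPrime] :
    ∃ f : C →ₐ[κ] κ, RingHom.ker f = p := by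
  have hbij : Function.Bijective (Algebra.ofId κ (C ⧸ p)) := by
    refine ⟨(algebraMap κ (C ⧸ p)).injective, fun y => ?_⟩
    obtain ⟨x, rfl⟩ := Ideal.Quotient.mk_surjective y
    obtain ⟨a, u, hu, h⟩ := exists_notMem_mul_eq hc htop p x
    refine ⟨a, ?_⟩
    have hm : u * (algebraMap κ C a - x) ∈ p := by rw [mul_sub, h, sub_self]; exact p.zero_mem
    exact Ideal.Quotient.eq.2 ((hp.mem_or_mem hm).resolve_left hu)
  refine ⟨(AlgEquiv.ofBijective _ hbij).symm.toAlgHom.comp (Ideal.Quotient.mkₐ κ p), ?_⟩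
  ext x
  rw [RingHom.mem_ker]
  simp [Ideal.Quotient.eq_zero_iff_mem]

/-- The rational points of an algebra generated by idempotents separate its elements. -/
theorem eq_zero_of_forall_algHom (hc : ∀ i, IsIdempotentElem (c i))
    (htop : Algebra.adjoin κ (Set.range c) = ⊤) (x : C) (hx : ∀ f : C →ₐ[κ] κ, f x = 0) :
    x = 0 := by
  by_contra hne
  -- At a maximal ideal over the annihilator of `x`, the local scalar value of `x` is 0, so some `u`
  -- outside that ideal annihilates `x`: a contradiction.
  obtain ⟨m, hm, hle⟩ := Ideal.exists_le_maximal (Module.annihilator C (Ideal.span {x})) (by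
    rw [Ne, Module.annihilator_eq_top_iff]
    rintro ⟨h⟩
    exact hne (congrArg Subtype.val
      (h ⟨x, Ideal.mem_span_singleton_self x⟩ ⟨0, Ideal.zero_mem _⟩)))
  obtain ⟨f, hf⟩ := exists_algHom_ker_eq hc htop m
  obtain ⟨a, u, hu, h⟩ := exists_notMem_mul_eq hc htop m x
  have hfu : f u ≠ 0 := fun h0 => hu (hf ▸ h0)
  have ha : a = 0 := by
    have := congrArg f h
    rw [map_mul, map_mul, hx f, mul_zero, AlgHom.commutes] at this
    exact (mul_eq_zero.1 this.symm).resolve_left hfu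
  refine hu (hle (Module.mem_annihilator.2 fun y => Subtype.ext ?_))
  obtain ⟨z, hz⟩ := Ideal.mem_span_singleton'.1 y.2
  change u * (y : C) = 0
  rw [← hz, mul_left_comm, h, ha]
  simp

end GeneratedByIdempotents

variable {κ : Type u} {G : Type v} [Field κ] [Group G] (σ : G → G → κ)

/-! ### Covariance and vanishing products in the twisted partial group algebra. -/

section Relations

theorem gen_eq_zero_right (g : G) (H : σ g⁻¹ g = 0) : gen σ g⁻¹ = 0 := by
  simpa [gen_one] using gen_zero_right σ g⁻¹ g H

theorem gen_eq_zero_of_factor (g : G) (H : σ g g⁻¹ = 0) : gen σ g = 0 := by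
  simpa using gen_eq_zero_right σ g⁻¹ (by simpa using H)

theorem idem_mul_gen (g : G) : idem σ g * gen σ g = gen σ g := by
  by_cases H : σ g g⁻¹ = 0
  · simp [gen_eq_zero_of_factor σ g H]
  · rw [idem, smul_mul_assoc, gen_mul_inv_mul, smul_smul, inv_mul_cancel₀ H, one_smul]

theorem gen_inv_mul_idem (g : G) : gen σ g⁻¹ * idem σ g = gen σ g⁻¹ := by
  by_cases H : σ g g⁻¹ = 0
  · simp [gen_eq_zero σ g⁻¹ (by simpa using H)]
  · have h := gen_left_mul σ g g⁻¹
    rw [mul_inv_cancel, gen_one, mul_one] at h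
    rw [idem, mul_smul_comm, ← mul_assoc, h, smul_smul, inv_mul_cancel₀ H, one_smul]

theorem gen_mul_gen (g h : G) : gen σ g * gen σ h = σ g h • (idem σ g * gen σ (g * h)) := by
  conv_lhs => rw [← idem_mul_gen σ g]
  rw [idem, smul_mul_assoc, smul_mul_assoc, mul_assoc, mul_assoc, ← mul_assoc (gen σ g⁻¹),
    gen_left_mul, mul_smul_comm, smul_comm, smul_mul_assoc, mul_assoc]

/-- Both sides are multiples of `[gh][h⁻¹]`. Thus `e_{gh}` fixes the left side from the left and
`e_h` fixes the right side from the right, so both equal `e_{gh} [g] e_h`; the scalars need not be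
compared. -/
theorem gen_mul_idem (g h : G) : gen σ g * idem σ h = idem σ (g * h) * gen σ g := by
  have hα : gen σ g * idem σ h
      = ((σ h h⁻¹)⁻¹ * σ g h) • (gen σ (g * h) * gen σ h⁻¹) := by
    rw [idem, mul_smul_comm, ← mul_assoc, gen_right_mul, smul_smul]
  have hβ : idem σ (g * h) * gen σ g
      = ((σ (g * h) (g * h)⁻¹)⁻¹ * σ (g * h)⁻¹ g) • (gen σ (g * h) * gen σ h⁻¹) := by
    have := gen_left_mul σ (g * h)⁻¹ g
    rw [inv_inv, show (g * h)⁻¹ * g = h⁻¹ by group] at this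
    rw [idem, smul_mul_assoc, this, smul_smul]
  have h1 : idem σ (g * h) * (gen σ g * idem σ h) = gen σ g * idem σ h := by
    rw [hα, mul_smul_comm, ← mul_assoc, idem_mul_gen]
  have h2 : idem σ (g * h) * gen σ g * idem σ h = idem σ (g * h) * gen σ g := by
    rw [hβ, smul_mul_assoc, mul_assoc, gen_inv_mul_idem]
  rw [← h1, ← mul_assoc, h2]

theorem idem_mul_idem_of_factor_eq_zero (g h : G) (H : σ g h = 0) :
    idem σ g * idem σ (g * h) = 0 := by
  have : gen σ g * gen σ g⁻¹ * (gen σ (g * h) * gen σ (g * h)⁻¹) = 0 := by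
    rw [mul_assoc, ← mul_assoc (gen σ g⁻¹), gen_zero_left σ g h H, zero_mul, mul_zero]
  rw [idem, idem, smul_mul_smul_comm, this, smul_zero]

/-- The two bracketings of `[g][h][t]` are multiples of the same element, with different scalars, so
that element vanishes. -/
theorem idem_mul_idem_mul_idem_of_cocycle_ne (g h t : G)
    (H : σ g h * σ (g * h) t ≠ σ g (h * t) * σ h t) :
    idem σ g * idem σ (g * h) * idem σ (g * h * t) = 0 := by
  have h1 : gen σ g * gen σ h * gen σ t
      = (σ g h * σ (g * h) t) • (idem σ g * idem σ (g * h) * gen σ (g * h * t)) := by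
    rw [gen_mul_gen, smul_mul_assoc, mul_assoc, gen_mul_gen σ (g * h), mul_smul_comm, smul_smul,
      ← mul_assoc (idem σ g)]
  have h2 : gen σ g * gen σ h * gen σ t
      = (σ g (h * t) * σ h t) • (idem σ g * idem σ (g * h) * gen σ (g * h * t)) := by
    rw [mul_assoc, gen_mul_gen σ h, mul_smul_comm, ← mul_assoc, gen_mul_idem, mul_assoc,
      gen_mul_gen σ g, mul_smul_comm, smul_smul, ← mul_assoc (idem σ (g * h)),
      idem_mul_comm σ (g * h) g, ← mul_assoc g h t, mul_comm (σ h t)]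
  have h3 : idem σ g * idem σ (g * h) * gen σ (g * h * t) = 0 := by
    rw [h1, ← sub_eq_zero, ← sub_smul] at h2
    exact (smul_eq_zero.1 h2).resolve_left (sub_ne_zero.2 H)
  rw [idem.eq_def σ (g * h * t), mul_smul_comm, ← mul_assoc, h3, zero_mul, smul_zero]

/-- Conjugation by `[s]` translates indices by `s`; this reduces products based at `s` to those
based at 1. The trailing `x` makes it usable inside longer products. -/
theorem idem_mul_eq_smul (s g : G) :
    ∀ x, idem σ s * (idem σ (s * g) * x)
      = (σ s s⁻¹)⁻¹ • (gen σ s * (idem σ g * (gen σ s⁻¹ * x))) := by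
  intro x
  have := gen_mul_idem σ s⁻¹ (s * g)
  rw [inv_mul_cancel_left] at this
  rw [idem, smul_mul_assoc, mul_assoc, ← mul_assoc (gen σ s⁻¹), this, mul_assoc]

theorem idem_mul_three (s g h : G) (H : σ g h = 0) :
    idem σ s * idem σ (s * g) * idem σ (s * g * h) = 0 := by
  have := gen_mul_idem σ s⁻¹ (s * g * h)
  rw [mul_assoc s, inv_mul_cancel_left] at this
  rw [mul_assoc, idem_mul_eq_smul, mul_assoc s, this, ← mul_assoc (idem σ g),
    idem_mul_idem_of_factor_eq_zero σ g h H]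
  simp

theorem idem_mul_four (s g h t : G) (H : σ g h * σ (g * h) t ≠ σ g (h * t) * σ h t) :
    idem σ s * idem σ (s * g) * idem σ (s * g * h) * idem σ (s * g * h * t) = 0 := by
  have h1 := gen_mul_idem σ s⁻¹ (s * g * h)
  rw [mul_assoc s, inv_mul_cancel_left] at h1
  have h2 := gen_mul_idem σ s⁻¹ (s * (g * h) * t)
  rw [mul_assoc s, inv_mul_cancel_left] at h2
  rw [mul_assoc, mul_assoc, idem_mul_eq_smul, mul_assoc s, ← mul_assoc (gen σ s⁻¹), h1,
    mul_assoc (idem σ (g * h)), mul_assoc s, h2, ← mul_assoc (idem σ g),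
    ← mul_assoc (idem σ g * idem σ (g * h)), idem_mul_idem_mul_idem_of_cocycle_ne σ g h t H]
  simp

end Relations

/-! ### The representation attached to a point of `Ω_σ`. -/

section Points

variable {σ} {ξ : G → Bool}

/-- The action of `[g]` on the functions on `ξ`. -/
def opGen (σ : G → G → κ) (ξ : G → Bool) (g : G) :
    Module.End κ ({x : G // ξ x = true} → κ) where
  -- Reading `φ` as the formal sum of `φ y • δ_{y⁻¹}`, this is the twisted regular rule `δ_h ↦
  -- σ(g,h) δ_{gh}`, truncated to `ξ`.
  toFun φ y := if h : ξ (y * g) = true then σ g (y * g)⁻¹ * φ ⟨y * g, h⟩ else 0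
  map_add' φ ψ := by
    ext y
    by_cases h : ξ (y * g) = true <;> simp [h, mul_add]
  map_smul' a φ := by
    ext y
    by_cases h : ξ (y * g) = true <;> simp [h, mul_left_comm]

theorem opGen_apply (g : G) (φ : {x : G // ξ x = true} → κ) (y : {x : G // ξ x = true}) :
    opGen σ ξ g φ y = if h : ξ (y * g) = true then σ g (y * g)⁻¹ * φ ⟨y * g, h⟩ else 0 :=
  rfl

theorem factor_ne_zero (hξ : ξ ∈ OmegaSigma σ) {h g s : G} (h1 : ξ h = true)
    (h2 : ξ (h * g) = true) (h3 : ξ (h * g * s) = true) : σ g s ≠ 0 := by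
  intro h0
  refine hξ.2 _ (Or.inl ⟨h, g, s, h0, rfl⟩) ?_
  rintro x (rfl | rfl | rfl) <;> assumption

theorem factor_cocycle (hξ : ξ ∈ OmegaSigma σ) {h g s t : G} (h1 : ξ h = true)
    (h2 : ξ (h * g) = true) (h3 : ξ (h * g * s) = true) (h4 : ξ (h * g * s * t) = true) :
    σ g (s * t) * σ s t = σ g s * σ (g * s) t := by
  by_contra h0
  refine hξ.2 _ (Or.inr ⟨h, g, s, t, h0, rfl⟩) ?_
  rintro x (rfl | rfl | rfl | rfl) <;> assumption

/-- The product rule is valid only where `y * g` stays in `ξ`; elsewhere the left side vanishes but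
the right side may not. This is why the representation is only partial. -/
theorem opGen_mul_apply (hξ : ξ ∈ OmegaSigma σ) (g h : G) (φ : {x : G // ξ x = true} → κ)
    (y : {x : G // ξ x = true}) (hy : ξ (y * g) = true) :
    opGen σ ξ g (opGen σ ξ h φ) y = σ g h * opGen σ ξ (g * h) φ y := by
  obtain ⟨y, hy1⟩ := y
  have hone : ξ 1 = true := hξ.1
  simp only [opGen_apply, ← mul_assoc]
  rw [dif_pos hy]
  by_cases h3 : ξ (y * g * h) = true
  -- The choice of `t` closes the path `y, yg, ygh` at 1, which lies in `ξ`.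
  · have := factor_cocycle (t := (y * g * h)⁻¹) hξ hy1 hy h3 (by simpa using hone)
    rw [show h * (y * g * h)⁻¹ = (y * g)⁻¹ by group] at this
    simp only [h3, dif_pos]
    rw [← mul_assoc, this, mul_assoc]
  · simp [h3]

theorem opGen_mul_apply_of_not (g h : G) (φ : {x : G // ξ x = true} → κ)
    (y : {x : G // ξ x = true}) (hy : ¬ ξ (y * g) = true) :
    opGen σ ξ g (opGen σ ξ h φ) y = 0 := by
  rw [opGen_apply, dif_neg hy]

theorem opGen_one (hξ : ξ ∈ OmegaSigma σ) (hl : ∀ h, σ 1 h ≠ 0 → σ 1 h = 1) :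
    opGen σ ξ 1 = 1 := by
  ext φ y
  have hone : ξ 1 = true := hξ.1
  obtain ⟨y, hy⟩ := y
  have := hl y⁻¹ (factor_ne_zero (h := y) hξ hy (by simpa using hy) (by simpa using hone))
  simp [opGen_apply, hy, this]

theorem opGen_rel (hξ : ξ ∈ OmegaSigma σ) (hl : ∀ h, σ 1 h ≠ 0 → σ 1 h = 1)
    {x y : FreeAlgebra κ G} (hxy : Rel σ x y) :
    FreeAlgebra.lift κ (opGen σ ξ) x = FreeAlgebra.lift κ (opGen σ ξ) y := by
  induction hxy with
  | zero_left g h H =>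
    simp only [map_mul, map_zero, FreeAlgebra.lift_ι_apply]
    refine LinearMap.ext fun φ => funext fun y => ?_
    simp only [Module.End.mul_apply, LinearMap.zero_apply, Pi.zero_apply, opGen_apply]
    split_ifs with h1 h2
    · refine absurd H (factor_ne_zero (h := y * g⁻¹) hξ h1 (by simpa using y.2) ?_)
      simpa [mul_assoc] using h2
    · simp
    · rfl
  | zero_right g h H =>
    simp only [map_mul, map_zero, FreeAlgebra.lift_ι_apply]
    refine LinearMap.ext fun φ => funext fun y => ?_
    simp only [Module.End.mul_apply, LinearMap.zero_apply, Pi.zero_apply, opGen_apply]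
    split_ifs with h1 h2
    · refine absurd H (factor_ne_zero (h := y) hξ y.2 ?_ ?_)
      · simpa [mul_assoc] using h2
      · simpa [mul_assoc] using h1
    · simp
    · rfl
  | left_mul g h =>
    simp only [map_mul, map_smul, FreeAlgebra.lift_ι_apply]
    refine LinearMap.ext fun φ => funext fun y => ?_
    simp only [Module.End.mul_apply, LinearMap.smul_apply, Pi.smul_apply, smul_eq_mul]
    rw [opGen_apply g⁻¹, opGen_apply g⁻¹]
    split_ifs with h1
    -- After `g⁻¹`, the step by `g` returns to `y`, so the product rule always applies.
    · rw [opGen_mul_apply hξ _ _ _ _ (by simpa using y.2)]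
      ring
    · simp
  | right_mul g h =>
    simp only [map_mul, map_smul, FreeAlgebra.lift_ι_apply]
    refine LinearMap.ext fun φ => funext fun y => ?_
    simp only [Module.End.mul_apply, LinearMap.smul_apply, Pi.smul_apply, smul_eq_mul]
    by_cases h1 : ξ (y * g) = true
    · rw [opGen_mul_apply hξ _ _ _ _ h1]
    -- The path on the right side, by `gh` and then `h⁻¹`, also ends at `yg`, which is outside `ξ`.
    · rw [opGen_mul_apply_of_not _ _ _ _ h1, opGen_apply (g * h)]
      simp only [opGen_apply h⁻¹]
      split_ifs with h2 h3
      · exact absurd (by simpa [mul_assoc] using h3) h1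
      · simp
      · simp
  | one => simp [opGen_one hξ hl]

theorem exists_algHom_end (hξ : ξ ∈ OmegaSigma σ) (hl : ∀ h, σ 1 h ≠ 0 → σ 1 h = 1) :
    ∃ ρ : KPar σ →ₐ[κ] Module.End κ ({x : G // ξ x = true} → κ),
      ∀ g, ρ (gen σ g) = opGen σ ξ g :=
  ⟨RingQuot.liftAlgHom κ ⟨FreeAlgebra.lift κ (opGen σ ξ), fun _ _ h => opGen_rel hξ hl h⟩,
    fun g => by
      refine (RingQuot.liftAlgHom_mkAlgHom_apply κ _ _ _).trans ?_
      simp⟩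

/-- Every point of `Ω_σ` gives a rational point of `B^σ`. -/
theorem exists_algHom_of_mem_omega (hξ : ξ ∈ OmegaSigma σ) (hl : ∀ h, σ 1 h ≠ 0 → σ 1 h = 1) :
    ∃ f : Bsigma σ →ₐ[κ] κ, ∀ g, f (eSigma σ g) = if ξ g then 1 else 0 := by
  obtain ⟨ρ, hρ⟩ := exists_algHom_end hξ hl
  have hone : ξ 1 = true := hξ.1
  have hidem : ∀ g φ, ρ (idem σ g) φ ⟨1, hone⟩ = (if ξ g then 1 else 0) * φ ⟨1, hone⟩ := by
    intro g φ
    simp only [idem, map_smul, map_mul, hρ, LinearMap.smul_apply, Pi.smul_apply,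
      Module.End.mul_apply, smul_eq_mul]
    by_cases hg : ξ g = true
    · rw [opGen_mul_apply hξ _ _ _ _ (by simpa using hg), mul_inv_cancel, opGen_one hξ hl,
        ← mul_assoc, inv_mul_cancel₀ (factor_ne_zero (h := 1) hξ hone (by simpa using hg)
        (by simpa using hone))]
      simp [hg]
    · rw [opGen_mul_apply_of_not _ _ _ _ (by simpa using hg)]
      simp [hg]
  -- Evaluation at the coordinate 1 is a common eigenfunctional of `B^σ`; its eigenvalue, read off
  -- on the constant function 1, is the desired character.
  have hB : ∀ x ∈ Bsigma σ, ∀ φ,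
      ρ x φ ⟨1, hone⟩ = ρ x (fun _ => 1) ⟨1, hone⟩ * φ ⟨1, hone⟩ := by
    intro x hx
    induction hx using Algebra.adjoin_induction with
    | mem x hx =>
      obtain ⟨g, rfl⟩ := hx
      intro φ
      rw [hidem, hidem, mul_one]
    | algebraMap r => simp [AlgHom.commutes, Module.algebraMap_end_apply]
    | add x y _ _ hx hy =>
      intro φ
      simp only [map_add, LinearMap.add_apply, Pi.add_apply]
      rw [hx φ, hy φ, add_mul]
    | mul x y _ _ hx hy =>
      intro φ
      simp only [map_mul, Module.End.mul_apply]
      rw [hx (ρ y φ), hx (ρ y fun _ => 1), hy φ, mul_assoc]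
  refine ⟨AlgHom.ofLinearMap
    { toFun := fun x => ρ (x : KPar σ) (fun _ => 1) ⟨1, hone⟩
      map_add' := fun x y => by simp
      map_smul' := fun a x => by simp } ?_ ?_, fun g => ?_⟩
  · simp
  · intro x y
    simp only [LinearMap.coe_mk, AddHom.coe_mk, MulMemClass.coe_mul, map_mul,
      Module.End.mul_apply]
    rw [hB x x.2]
  · exact (hidem g _).trans (mul_one _)

end Points

/-! ### Identities in `B^σ` and generation by the `e_g^σ`. -/

section Spectrum

theorem factor_one_left {σ : G → G → κ} (hσ : IsFactorSet.{w} σ) (h : G) (H : σ 1 h ≠ 0) :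
    σ 1 h = 1 := by
  obtain ⟨R, _, _, Γ, hΓ⟩ := hσ
  have h1 := hΓ.left_mul 1 h
  simp only [inv_one, hΓ.map_one, one_mul] at h1
  have h2 : (1 - σ 1 h) • Γ h = 0 := by rw [sub_smul, one_smul, ← h1, sub_self]
  -- Nonvanishing of `σ 1 h` forces `Γ h ≠ 0`, so the scalar can be cancelled.
  have h3 : Γ h ≠ 0 := fun h0 => H (hΓ.factor_eq_zero 1 h (by rw [h0, mul_zero]))
  exact (sub_eq_zero.1 ((smul_eq_zero.1 h2).resolve_right h3)).symm

theorem isIdempotentElem_eSigma (g : G) : IsIdempotentElem (eSigma σ g) :=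
  Subtype.ext (isIdempotentElem_idem σ g)

theorem eSigma_one : eSigma σ 1 = 1 :=
  Subtype.ext (show idem σ 1 = 1 by simpa [gen_one] using idem_mul_gen σ 1)

theorem eSigma_mul_three (s g h : G) (H : σ g h = 0) :
    eSigma σ s * eSigma σ (s * g) * eSigma σ (s * g * h) = 0 :=
  Subtype.ext (idem_mul_three σ s g h H)

theorem eSigma_mul_four (s g h t : G) (H : σ g h * σ (g * h) t ≠ σ g (h * t) * σ h t) :
    eSigma σ s * eSigma σ (s * g) * eSigma σ (s * g * h) * eSigma σ (s * g * h * t) = 0 :=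
  Subtype.ext (idem_mul_four σ s g h t H)

theorem adjoin_range_eSigma : Algebra.adjoin κ (Set.range (eSigma σ)) = ⊤ := by
  have h : Set.range (eSigma σ)
      = ((↑) : Algebra.adjoin κ (Set.range (idem σ)) → KPar σ) ⁻¹' Set.range (idem σ) := by
    ext x
    constructor
    · rintro ⟨g, rfl⟩
      exact ⟨g, rfl⟩
    · rintro ⟨g, hg⟩
      exact ⟨g, Subtype.ext hg⟩
  rw [h]
  exact Algebra.adjoin_adjoin_coe_preimage

variable {σ} in
theorem algHom_ext_eSigma {A : Type*} [Semiring A] [Algebra κ A] {f f' : Bsigma σ →ₐ[κ] A}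
    (h : ∀ g, f (eSigma σ g) = f' (eSigma σ g)) : f = f' :=
  AlgHom.ext_of_adjoin_eq_top (adjoin_range_eSigma σ) (by rintro _ ⟨g, rfl⟩; exact h g)

/-! ### Points and universal property of `B`, and its quotient by `I_σ`. -/

theorem mem_omega_one {ξ : G → Bool} (h : 1 ∈ toSet ξ) :
    ξ ∈ OmegaSigma (fun _ _ : G => (1 : κ)) := by
  refine ⟨h, ?_⟩
  rintro V (⟨_, _, _, h0, _⟩ | ⟨_, _, _, _, h0, _⟩)
  · exact absurd h0 one_ne_zero
  · exact absurd rfl h0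

theorem existsUnique_point {ξ : G → Bool} (h : 1 ∈ toSet ξ) :
    ∃! f : B κ G →ₐ[κ] κ, ∀ g : G, f (e κ g) = if ξ g then 1 else 0 := by
  obtain ⟨f, hf⟩ := exists_algHom_of_mem_omega (mem_omega_one (κ := κ) h) (fun _ _ => rfl)
  exact ⟨f, hf, fun f' hf' => algHom_ext_eSigma fun g => (hf' g).trans (hf g).symm⟩

/-- The indicator of the generators not killed by a point. -/
theorem exists_indicator {C : Type*} [CommRing C] [Algebra κ C] {c : G → C}
    (hc : ∀ g, IsIdempotentElem (c g)) (h1 : c 1 = 1) (f : C →ₐ[κ] κ) :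
    ∃ ξ : G → Bool, 1 ∈ toSet ξ ∧ ∀ g, f (c g) = if ξ g then 1 else 0 := by
  classical
  refine ⟨fun g => decide (f (c g) = 1), by simp [toSet, h1], fun g => ?_⟩
  rcases IsIdempotentElem.iff_eq_zero_or_one.1 ((hc g).map f) with h | h <;> simp [h]

/-- `B` is the free commutative algebra on idempotents indexed by `G`, that of `1` being `1`. -/
theorem existsUnique_lift {A : Type*} [CommRing A] [Algebra κ A] (a : G → A)
    (ha : ∀ g, IsIdempotentElem (a g)) (ha1 : a 1 = 1) :
    ∃! φ : B κ G →ₐ[κ] A, ∀ g, φ (e κ g) = a g := by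
  -- `S` is the graph of the sought homomorphism: its projection to `B` is bijective because every
  -- point of `S` comes from a subset containing 1, hence from a point of `B`.
  let S : Subalgebra κ (B κ G × A) := Algebra.adjoin κ (Set.range fun g => (e κ g, a g))
  let c : G → S := fun g => ⟨(e κ g, a g), Algebra.subset_adjoin ⟨g, rfl⟩⟩
  have hc : ∀ g, IsIdempotentElem (c g) := fun g =>
    Subtype.ext (Prod.ext (isIdempotentElem_eSigma _ g) (ha g))
  have hc1 : c 1 = 1 := Subtype.ext (Prod.ext (eSigma_one _) ha1)
  have htop : Algebra.adjoin κ (Set.range c) = ⊤ := by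
    have h : Set.range c = ((↑) : S → B κ G × A) ⁻¹' Set.range fun g => (e κ g, a g) := by
      ext x
      constructor
      · rintro ⟨g, rfl⟩
        exact ⟨g, rfl⟩
      · rintro ⟨g, hg⟩
        exact ⟨g, Subtype.ext hg⟩
    rw [h]
    exact Algebra.adjoin_adjoin_coe_preimage
  let π : S →ₐ[κ] B κ G := (AlgHom.fst κ (B κ G) A).comp S.val
  have hπ : ∀ g, π (c g) = e κ g := fun _ => rfl
  have hbij : Function.Bijective π := by
    constructor
    · rw [injective_iff_map_eq_zero]
      intro x hx
      refine eq_zero_of_forall_algHom hc htop x fun f => ?_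
      obtain ⟨ξ, hξ1, hξ⟩ := exists_indicator hc hc1 f
      obtain ⟨f', hf', -⟩ := existsUnique_point (κ := κ) hξ1
      have : f = f'.comp π := AlgHom.ext_of_adjoin_eq_top htop (by
        rintro _ ⟨g, rfl⟩
        rw [AlgHom.comp_apply, hπ, hξ, hf'])
      rw [this, AlgHom.comp_apply, hx, map_zero]
    · rw [← AlgHom.range_eq_top, eq_top_iff, ← adjoin_range_eSigma, Algebra.adjoin_le_iff]
      rintro _ ⟨g, rfl⟩
      exact ⟨c g, hπ g⟩
  refine ⟨((AlgHom.snd κ (B κ G) A).comp S.val).comp (AlgEquiv.ofBijective π hbij).symm.toAlgHom,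
    fun g => ?_, fun φ hφ => algHom_ext_eSigma fun g => ?_⟩
  all_goals
    have : (AlgEquiv.ofBijective π hbij).symm (e κ g) = c g :=
      (AlgEquiv.symm_apply_eq _).2 (hπ g).symm
  · simp [this, c]
  · rw [hφ]
    simp [this, c]

/-- On a generator of `I_σ`, `f` takes the value 1 if the corresponding prohibition lies in `ξ`, and
0 otherwise. -/
theorem mem_omega_iff_Isigma_le {ξ : G → Bool} {f : B κ G →ₐ[κ] κ} (h1 : 1 ∈ toSet ξ)
    (hf : ∀ g : G, f (e κ g) = if ξ g then 1 else 0) :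
    ξ ∈ OmegaSigma σ ↔ Isigma σ ≤ RingHom.ker f := by
  constructor
  · intro hξ
    rw [Isigma, Ideal.span_le]
    rintro _ (⟨s, g, h, H, rfl⟩ | ⟨s, g, h, t, H, rfl⟩)
    · rw [SetLike.mem_coe, RingHom.mem_ker]
      by_contra hne
      simp only [map_mul, hf] at hne
      by_cases a1 : ξ s <;> by_cases a2 : ξ (s * g) <;> by_cases a3 : ξ (s * g * h) <;>
        simp [a1, a2, a3] at hne
      exact factor_ne_zero hξ a1 a2 a3 H
    · rw [SetLike.mem_coe, RingHom.mem_ker]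
      by_contra hne
      simp only [map_mul, hf] at hne
      by_cases a1 : ξ s <;> by_cases a2 : ξ (s * g) <;> by_cases a3 : ξ (s * g * h) <;>
        by_cases a4 : ξ (s * g * h * t) <;> simp [a1, a2, a3, a4] at hne
      exact H (factor_cocycle hξ a1 a2 a3 a4).symm
  · intro hle
    refine ⟨h1, ?_⟩
    rintro _ (⟨h, g, s, H, rfl⟩ | ⟨h, g, s, t, H, rfl⟩) hV
    · have := hle (Ideal.subset_span (Or.inl ⟨h, g, s, H, rfl⟩))
      rw [RingHom.mem_ker] at this
      simp only [Set.insert_subset_iff, Set.singleton_subset_iff, toSet, Set.mem_ofPred_eq] at hV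
      simp [map_mul, hf, hV] at this
    · have := hle (Ideal.subset_span (Or.inr ⟨h, g, s, t, Ne.symm H, rfl⟩))
      rw [RingHom.mem_ker] at this
      simp only [Set.insert_subset_iff, Set.singleton_subset_iff, toSet, Set.mem_ofPred_eq] at hV
      simp [map_mul, hf, hV] at this

/-- The quotient of `B` by `I_σ` is `B^σ`. -/
theorem exists_quotient_algEquiv (hl : ∀ h, σ 1 h ≠ 0 → σ 1 h = 1) :
    ∃ Φ : (B κ G ⧸ Isigma σ) ≃ₐ[κ] Bsigma σ,
      ∀ g : G, Φ (Ideal.Quotient.mk (Isigma σ) (e κ g)) = eSigma σ g := by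
  obtain ⟨φ, hφ, -⟩ := existsUnique_lift (κ := κ) (eSigma σ) (isIdempotentElem_eSigma σ)
    (eSigma_one σ)
  have hker : ∀ x ∈ Isigma σ, φ x = 0 := by
    have : Isigma σ ≤ RingHom.ker φ := by
      rw [Isigma, Ideal.span_le]
      rintro _ (⟨s, g, h, H, rfl⟩ | ⟨s, g, h, t, H, rfl⟩)
      · rw [SetLike.mem_coe, RingHom.mem_ker]
        simp only [map_mul, hφ]
        exact eSigma_mul_three σ s g h H
      · rw [SetLike.mem_coe, RingHom.mem_ker]
        simp only [map_mul, hφ]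
        exact eSigma_mul_four σ s g h t H
    exact fun x hx => this hx
  let q : B κ G →ₐ[κ] B κ G ⧸ Isigma σ := Ideal.Quotient.mkₐ κ (Isigma σ)
  have hq : Function.Surjective q := Ideal.Quotient.mk_surjective
  have hqi : ∀ g, IsIdempotentElem (q (e κ g)) := fun g => (isIdempotentElem_eSigma _ g).map q
  have hq1 : q (e κ 1) = 1 := by rw [e, eSigma_one, map_one]
  have htop : Algebra.adjoin κ (Set.range fun g => q (e κ g)) = ⊤ := by
    have h : (Set.range fun g => q (e κ g)) = q '' Set.range (e κ) := by
      rw [← Set.range_comp]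
      rfl
    rw [h, Algebra.adjoin_image, adjoin_range_eSigma, Algebra.map_top]
    exact (AlgHom.range_eq_top q).2 hq
  let Φ : (B κ G ⧸ Isigma σ) →ₐ[κ] Bsigma σ := Ideal.Quotient.liftₐ (Isigma σ) φ hker
  have hΦ : ∀ g, Φ (q (e κ g)) = eSigma σ g := fun g => hφ g
  have hbij : Function.Bijective Φ := by
    constructor
    · rw [injective_iff_map_eq_zero]
      intro x hx
      refine eq_zero_of_forall_algHom hqi htop x fun f => ?_
      obtain ⟨ξ, hξ1, hξ⟩ := exists_indicator hqi hq1 f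
      -- A point of the quotient kills `I_σ` when pulled back to `B`, so it comes from `Ω_σ` and
      -- hence from a point of `B^σ`.
      have hmem : ξ ∈ OmegaSigma σ := by
        refine (mem_omega_iff_Isigma_le σ (f := f.comp q) hξ1 hξ).2 fun y hy => ?_
        rw [RingHom.mem_ker, AlgHom.comp_apply, show q y = 0 from
          Ideal.Quotient.eq_zero_iff_mem.2 hy, map_zero]
      obtain ⟨f', hf'⟩ := exists_algHom_of_mem_omega hmem hl
      have : f = f'.comp Φ := AlgHom.ext_of_adjoin_eq_top htop (by
        rintro _ ⟨g, rfl⟩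
        rw [AlgHom.comp_apply, hΦ, hξ, hf'])
      rw [this, AlgHom.comp_apply, hx, map_zero]
    · rw [← AlgHom.range_eq_top, eq_top_iff, ← adjoin_range_eSigma, Algebra.adjoin_le_iff]
      rintro _ ⟨g, rfl⟩
      exact ⟨_, hΦ g⟩
  exact ⟨AlgEquiv.ofBijective Φ hbij, hΦ⟩

/-! ### The homeomorphism from the spectrum of `B^σ` to `Ω_σ`. -/

open Classical in
/-- The point of `Ω_σ` attached to a prime of `B^σ`. -/
noncomputable def pointOfPrime (p : PrimeSpectrum (Bsigma σ)) : OmegaSigma σ :=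
  ⟨fun g => decide (eSigma σ g ∉ p.asIdeal), by
    refine ⟨by simpa [toSet, eSigma_one] using
      fun h => p.isPrime.ne_top ((Ideal.eq_top_iff_one _).2 h), ?_⟩
    rintro _ (⟨h, g, s, H, rfl⟩ | ⟨h, g, s, t, H, rfl⟩) hV
    · simp only [Set.insert_subset_iff, Set.singleton_subset_iff, toSet, Set.mem_ofPred_eq,
        decide_eq_true_eq] at hV
      have h0 := p.asIdeal.zero_mem
      rw [← eSigma_mul_three σ h g s H] at h0
      simp [p.isPrime.mul_mem_iff_mem_or_mem, hV] at h0
    · simp only [Set.insert_subset_iff, Set.singleton_subset_iff, toSet, Set.mem_ofPred_eq,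
        decide_eq_true_eq] at hV
      have h0 := p.asIdeal.zero_mem
      rw [← eSigma_mul_four σ h g s t (Ne.symm H)] at h0
      simp [p.isPrime.mul_mem_iff_mem_or_mem, hV] at h0⟩

theorem pointOfPrime_apply (p : PrimeSpectrum (Bsigma σ)) (g : G) :
    (pointOfPrime σ p : G → Bool) g = true ↔ eSigma σ g ∉ p.asIdeal := by
  simp [pointOfPrime]

/-- Each coordinate is the indicator of the basic open set of an idempotent, which is clopen. -/
theorem continuous_pointOfPrime : Continuous (pointOfPrime σ) := by
  refine Continuous.subtype_mk (continuous_pi fun g => ?_) _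
  rw [continuous_bool_rng true]
  have : (fun p : PrimeSpectrum (Bsigma σ) => (pointOfPrime σ p : G → Bool) g) ⁻¹' {true}
      = PrimeSpectrum.basicOpen (eSigma σ g) := by
    ext p
    simp [pointOfPrime_apply]
  change IsClopen ((fun p : PrimeSpectrum (Bsigma σ) =>
    (pointOfPrime σ p : G → Bool) g) ⁻¹' {true})
  rw [this]
  exact PrimeSpectrum.isClopen_iff.2 ⟨_, isIdempotentElem_eSigma σ g, rfl⟩

theorem bijective_pointOfPrime (hl : ∀ h, σ 1 h ≠ 0 → σ 1 h = 1) :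
    Function.Bijective (pointOfPrime σ) := by
  have hker : ∀ p : PrimeSpectrum (Bsigma σ), ∃ f : Bsigma σ →ₐ[κ] κ,
      RingHom.ker f = p.asIdeal ∧
        ∀ g, f (eSigma σ g) = if (pointOfPrime σ p : G → Bool) g then 1 else 0 := by
    intro p
    obtain ⟨f, hf⟩ :=
      exists_algHom_ker_eq (isIdempotentElem_eSigma σ) (adjoin_range_eSigma σ) p.asIdeal
    refine ⟨f, hf, fun g => ?_⟩
    have h := pointOfPrime_apply σ p g
    rw [← hf, RingHom.mem_ker] at h
    rcases IsIdempotentElem.iff_eq_zero_or_one.1 ((isIdempotentElem_eSigma σ g).map f)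
      with h' | h'
    · rw [if_neg (fun hg => h.1 hg h'), h']
    · rw [if_pos (h.2 (by rw [h']; exact one_ne_zero)), h']
  constructor
  · intro p p' h
    obtain ⟨f, hf, hfe⟩ := hker p
    obtain ⟨f', hf', hfe'⟩ := hker p'
    have : f = f' := algHom_ext_eSigma fun g => by rw [hfe, hfe', h]
    exact PrimeSpectrum.ext (by rw [← hf, ← hf', this])
  · rintro ⟨ξ, hξ⟩
    obtain ⟨f, hf⟩ := exists_algHom_of_mem_omega hξ hl
    refine ⟨⟨RingHom.ker f, RingHom.ker_isPrime f⟩, Subtype.ext (funext fun g => ?_)⟩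
    rw [Bool.eq_iff_iff, pointOfPrime_apply, RingHom.mem_ker, hf]
    simp

/-- The spectrum of `B^σ` is `Ω_σ`. -/
theorem exists_spectrum_homeomorph (hl : ∀ h, σ 1 h ≠ 0 → σ 1 h = 1) :
    ∃ Ψ : PrimeSpectrum (Bsigma σ) ≃ₜ OmegaSigma σ,
      ∀ (p : PrimeSpectrum (Bsigma σ)) (g : G),
        g ∈ toSet (Ψ p : G → Bool) ↔ eSigma σ g ∉ p.asIdeal :=
  -- The spectrum is compact and `Ω_σ` is Hausdorff, so a continuous bijection suffices.
  ⟨Continuous.homeoOfEquivCompactToT2 (f := Equiv.ofBijective _ (bijective_pointOfPrime σ hl))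
    (continuous_pointOfPrime σ), pointOfPrime_apply σ⟩

end Spectrum

end TwistedPartial

open TwistedPartial in
theorem mainTheorem7 {κ : Type u} {G : Type v} [Field κ] [Group G]
    (σ : G → G → κ) (hσ : IsFactorSet.{w} σ) :
    -- `B` is the free commutative algebra on idempotents `e_g` with `e_1 = 1`
    ((∀ g : G, IsIdempotentElem (e κ g)) ∧ e κ (1 : G) = 1 ∧
      ∀ (A : Type w') [CommRing A] [Algebra κ A] (a : G → A),
        (∀ g, IsIdempotentElem (a g)) → a 1 = 1 →
          ∃! φ : B κ G →ₐ[κ] A, ∀ g, φ (e κ g) = a g) ∧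
    -- `B / I_σ ≅ B^σ`
    (∃ Φ : (B κ G ⧸ Isigma σ) ≃ₐ[κ] Bsigma σ,
      ∀ g : G, Φ (Ideal.Quotient.mk (Isigma σ) (e κ g)) = eSigma σ g) ∧
    -- `Ω_σ` is the set of the `ξ ∋ 1` such that `I_σ ⊆ ker f_ξ`
    (∀ ξ : G → Bool, 1 ∈ toSet ξ →
      ∃! f : B κ G →ₐ[κ] κ, (∀ g : G, f (e κ g) = if ξ g then 1 else 0)) ∧
    (∀ (ξ : G → Bool) (f : B κ G →ₐ[κ] κ), 1 ∈ toSet ξ →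
      (∀ g : G, f (e κ g) = if ξ g then 1 else 0) →
        (ξ ∈ OmegaSigma σ ↔ Isigma σ ≤ RingHom.ker f)) ∧
    -- `Spec B^σ ≅ Ω_σ`
    (∃ Ψ : PrimeSpectrum (Bsigma σ) ≃ₜ OmegaSigma σ,
      ∀ (p : PrimeSpectrum (Bsigma σ)) (g : G),
        g ∈ toSet (Ψ p : G → Bool) ↔ eSigma σ g ∉ p.asIdeal) := by
  have hl := fun h => factor_one_left hσ h
  exact ⟨⟨isIdempotentElem_eSigma _, eSigma_one _, fun A _ _ a => existsUnique_lift a⟩,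
    exists_quotient_algEquiv σ hl, fun ξ => existsUnique_point,
    fun ξ f => mem_omega_iff_Isigma_le σ, exists_spectrum_homeomorph σ hl⟩
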